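/- Let $G$ be a finite simple graph with at least two vertices that is 4-connected, meaning that for any two distinct vertices $u,v$ of $G$ there is a set of four pairwise internally disjoint $u$-$v$ paths (no two of them share a vertex other than $u$ and $v$). A longest path of $G$ is a path (without repeated vertices) whose number of edges is maximum among all paths of $G$. Then every two longest paths $P$ and $Q$ of $G$ share at least four vertices: $|V(P)\cap V(Q)|\ge 4$. -/

import Mathlib

namespace SimpleGraph

variable {V : Type*}

/-- Two `u`-`v` paths are internally disjoint: they have no internal vertex in common, that is,
every vertex lying on both of them is one of the ends `u`, `v`. -/
def InternallyDisjoint {G : SimpleGraph V} {u v : V} (p q : G.Path u v) : Prop :=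
  ∀ x : V, x ∈ (p : G.Walk u v).support → x ∈ (q : G.Walk u v).support → x = u ∨ x = v

/-- `G` is `k`-connected: for any two (distinct) vertices `u` and `v` there is a set of `k`
(different) pairwise internally disjoint `u`-`v` paths. -/
def IsKConnected (G : SimpleGraph V) (k : ℕ) : Prop :=
  ∀ u v : V, u ≠ v → ∃ S : Finset (G.Path u v), S.card = k ∧
    ∀ p ∈ S, ∀ q ∈ S, p ≠ q → InternallyDisjoint p q

/-- `p` is a longest path of `G`: it is a path, and no path of `G` (between any two vertices)
has more edges. -/
def IsLongestPath {G : SimpleGraph V} {u v : V} (p : G.Walk u v) : Prop :=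
  p.IsPath ∧ ∀ (x y : V) (q : G.Walk x y), q.IsPath → q.length ≤ p.length

end SimpleGraph

namespace SimpleGraph

variable {W : Type*} {G : SimpleGraph W}

/-! Adding an apex adjacent to every vertex turns the longest paths `P` and `Q` into longest cycles,
with `N` vertices, of the cone. If the paths shared at most three vertices, the cycles would share
at most four, apex included, and by 4-connectedness any two vertices outside this common set `X`
could be connected outside `X`. The contradiction is that the common vertices of two such longest
cycles always separate.

The common vertices cut the cycles into arcs. Up to rotation and reversal, at most four points lie
on the two cycles either in the same cyclic order (`ParallelCycles`) or in orders that differ by one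
swap (`TwistedCycles`). Arcs of the two cycles with the same ends have equal length, since otherwise
replacing one by the other would lengthen a cycle. Now let a path off both cycles connect inner
vertices of two arcs. Whenever the arcs can be recombined into two cycles that both use this path,
the two have `2 * N` vertices plus twice the length of the path, so one of them is too long.

In the twisted case this excludes every connection between the two cycles
(`TwistedCycles.not_joined`). In the parallel case it excludes equal and adjacent positions, so that
a connection between the cycles must join opposite arcs. Then a single recombined cycle shows that
an arc in between has inner vertices (`ParallelCycles.ne_nil_of_joined_opposite`), and connecting
one pair of opposite positions to the other pair joins adjacent ones after all. -/

/-- `Strand G u l v`: the list `l` runs through the vertices of a walk from `u` to `v`,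
the last vertex `v` being left out. -/
inductive Strand (G : SimpleGraph W) : W → List W → W → Prop
  | nil (u : W) : Strand G u [] u
  | cons {u v w : W} {l : List W} : G.Adj u v → Strand G v l w → Strand G u (u :: l) w

/-! ### Calculus of walks given by vertex lists -/

namespace Strand

theorem nil_iff {u v : W} : Strand G u [] v ↔ u = v :=
  ⟨fun h => by cases h; rfl, fun h => h ▸ .nil u⟩

/-- Leaving out the last vertex makes composition of walks the plain concatenation of lists, and
makes a closed walk list each vertex of a cycle once. -/
theorem append {u v w : W} {l m : List W} (h : Strand G u l v) (h' : Strand G v m w) :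
    Strand G u (l ++ m) w := by
  induction h with
  | nil => exact h'
  | cons ha _ ih => exact .cons ha (ih h')

theorem eq_cons {u v a : W} {l : List W} (h : Strand G u (a :: l) v) : a = u := by
  cases h; rfl

theorem split {u v s : W} {l m : List W} (h : Strand G u (l ++ s :: m) v) :
    Strand G u l s ∧ Strand G s (s :: m) v := by
  induction l generalizing u with
  | nil =>
    obtain rfl := h.eq_cons
    exact ⟨.nil _, h⟩
  | cons a l ih =>
    obtain rfl := h.eq_cons
    cases h with
    | cons ha h => exact ⟨.cons ha (ih h).1, (ih h).2⟩

theorem reverse {u v : W} {l : List W} (h : Strand G u (u :: l) v) :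
    Strand G v (v :: l.reverse) u := by
  induction l generalizing u with
  | nil =>
    cases h with
    | cons ha h => cases h; exact .cons ha.symm (.nil _)
  | cons a l ih =>
    cases h with
    | cons ha h =>
      obtain rfl := h.eq_cons
      simpa using (ih h).append (.cons ha.symm (.nil _))

/-- A shortest connection between two disjoint sets has no inner vertices in them. -/
theorem exists_connection {S T Z : Set W} {u v : W} {l : List W} (h : Strand G u l v)
    (hn : l.Nodup) (hST : Disjoint S T) (hu : u ∈ S) (hv : v ∈ T) (hZ : ∀ w ∈ l, w ∉ Z) :
    ∃ s ∈ S, ∃ t ∈ T, ∃ r : List W, Strand G s (s :: r) t ∧ r.Nodup ∧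
      ∀ w ∈ r, w ∉ S ∧ w ∉ T ∧ w ∉ Z := by
  induction hk : l.length using Nat.strong_induction_on generalizing u v l with
  | _ k ih =>
    cases l with
    | nil => exact absurd (nil_iff.1 h ▸ hv) (Set.disjoint_left.1 hST hu)
    | cons a l =>
      obtain rfl := h.eq_cons
      by_cases hl : ∀ w ∈ l, w ∉ S ∧ w ∉ T
      · exact ⟨a, hu, v, hv, l, h, (List.nodup_cons.1 hn).2,
          fun w hw => ⟨(hl w hw).1, (hl w hw).2, hZ w (List.mem_cons_of_mem _ hw)⟩⟩
      · push Not at hl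
        obtain ⟨w, hw, hwST⟩ := hl
        obtain ⟨l₁, l₂, rfl⟩ := List.append_of_mem hw
        have hs := (List.cons_append ▸ h : Strand G a ((a :: l₁) ++ w :: l₂) v).split
        by_cases hwS : w ∈ S
        · refine ih _ ?_ hs.2 (hn.sublist ?_) hwS hv (fun x hx => hZ x ?_) rfl
          · simp at hk ⊢; omega
          · exact (List.sublist_append_right _ _).cons _
          · simp at hx ⊢; tauto
        · refine ih _ ?_ hs.1 (hn.sublist ?_) hu (hwST hwS) (fun x hx => hZ x ?_) rfl
          · simp at hk ⊢; omega
          · exact List.Sublist.cons_cons _ (List.sublist_append_left _ _)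
          · simp at hx ⊢; tauto

end Strand

/-! ### Multiplicities and connections; disjointness becomes linear arithmetic on counts -/

/-- The indicator function of a vertex. -/
def vertexIndicator [DecidableEq W] (u w : W) : ℕ := if u = w then 1 else 0

theorem count_cons_eq [DecidableEq W] (u w : W) (l : List W) :
    (u :: l).count w = vertexIndicator u w + l.count w := by
  rw [List.count_cons, vertexIndicator, add_comm]; simp

theorem vertexIndicator_eq_zero [DecidableEq W] {X : Set W} {u w : W} (hu : u ∈ X) (hw : w ∉ X) :
    vertexIndicator u w = 0 :=
  if_neg (by rintro rfl; exact hw hu)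

/-- Two lists of vertices are joined if a path leads from one to the other, the inner vertices of
which are outside the support of `U`. -/
def Joined [DecidableEq W] (G : SimpleGraph W) (U : W → ℕ) (l m : List W) : Prop :=
  ∃ s ∈ l, ∃ t ∈ m, ∃ r : List W, Strand G s (s :: r) t ∧ ∀ w, r.count w + U w ≤ 1

theorem Joined.symm [DecidableEq W] {U : W → ℕ} {l m : List W} (h : Joined G U l m) :
    Joined G U m l := by
  obtain ⟨s, hs, t, ht, r, hr, hU⟩ := h
  exact ⟨t, ht, s, hs, r.reverse, hr.reverse, by simpa using hU⟩

theorem Joined.of_mem [DecidableEq W] {U : W → ℕ} {l m l' m' : List W} (h : Joined G U l m)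
    (hl : ∀ x ∈ l, x ∈ l') (hm : ∀ x ∈ m, x ∈ m') : Joined G U l' m' := by
  obtain ⟨s, hs, t, ht, r, hr⟩ := h
  exact ⟨s, hl s hs, t, hm t ht, r, hr⟩

/-! ### Longest cycles with the same cyclic order of common vertices -/

/-- Every cycle of `G` has at most `N` vertices. -/
def CircumferenceLE (G : SimpleGraph W) (N : ℕ) : Prop :=
  ∀ (u : W) (l : List W), Strand G u l u → l.Nodup → l.length ≤ N

/-- Two cycles of length `N` that run through their common vertices `x 0, …, x 3` in the same
cyclic order. The arcs `A i` and `B i` from `x i` to `x (i + 1)` may be empty. -/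
structure ParallelCycles [DecidableEq W] (G : SimpleGraph W) (N : ℕ) (U : W → ℕ)
    (x : Fin 4 → W) (A B : Fin 4 → List W) : Prop where
  strand_left : ∀ i, Strand G (x i) (A i) (x (i + 1))
  strand_right : ∀ i, Strand G (x i) (B i) (x (i + 1))
  length_eq : ∀ i, (A i).length = (B i).length
  length_sum : ∑ i, (A i).length = N
  count_eq : ∀ w, ∑ i, ((A i).count w + (B i).tail.count w) = U w

namespace ParallelCycles

variable [DecidableEq W] {N : ℕ} {U : W → ℕ} {x : Fin 4 → W} {A B : Fin 4 → List W}

theorem rotate (h : ParallelCycles G N U x A B) (k : Fin 4) :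
    ParallelCycles G N U (fun i => x (i + k)) (fun i => A (i + k)) (fun i => B (i + k)) where
  strand_left i := by rw [add_right_comm]; exact h.strand_left _
  strand_right i := by rw [add_right_comm]; exact h.strand_right _
  length_eq i := h.length_eq _
  length_sum := by
    rw [← h.length_sum]
    exact Equiv.sum_comp (Equiv.addRight k) fun i => (A i).length
  count_eq w := by
    rw [← h.count_eq w]
    exact Equiv.sum_comp (Equiv.addRight k) fun i => (A i).count w + (B i).tail.count w

theorem left_eq (h : ParallelCycles G N U x A B) {i : Fin 4} (hi : (A i).tail ≠ []) :
    A i = x i :: (A i).tail ∧ B i = x i :: (B i).tail := by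
  have h1 := h.strand_left i
  have h2 := h.strand_right i
  have h3 := h.length_eq i
  match hA : A i, hB : B i with
  | [], _ => simp [hA] at hi
  | a :: l, [] => simp [hA, hB] at h3
  | a :: l, b :: m =>
    rw [hA] at h1; rw [hB] at h2
    simp [h1.eq_cons, h2.eq_cons]

/-- Both arcs have the same first vertex, so it does not matter in which of the two it is counted.
This makes `count_eq` symmetric under swapping a pair of arcs. -/
theorem count_add_tail (h : ParallelCycles G N U x A B) (i : Fin 4) (w : W) :
    (B i).count w + (A i).tail.count w = (A i).count w + (B i).tail.count w := by
  have h1 := h.strand_left i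
  have h2 := h.strand_right i
  have h3 := h.length_eq i
  match hA : A i, hB : B i with
  | [], [] => rfl
  | [], b :: m => simp [hA, hB] at h3
  | a :: l, [] => simp [hA, hB] at h3
  | a :: l, b :: m =>
    rw [hA] at h1; rw [hB] at h2
    simp only [count_cons_eq, List.tail_cons, h1.eq_cons, h2.eq_cons]
    omega

/-- Since paired arcs have equal length, any mixture of them is again a pair of longest cycles.
Statements proved for arcs of `A` thus extend to all choices between `A` and `B`. -/
theorem exchange (h : ParallelCycles G N U x A B) (f : Fin 4 → Bool) :
    ParallelCycles G N U x (fun i => if f i then B i else A i)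
      (fun i => if f i then A i else B i) where
  strand_left i := by
    split_ifs
    exacts [h.strand_right i, h.strand_left i]
  strand_right i := by
    split_ifs
    exacts [h.strand_left i, h.strand_right i]
  length_eq i := by
    split_ifs
    exacts [(h.length_eq i).symm, h.length_eq i]
  length_sum := by
    rw [← h.length_sum]
    refine Finset.sum_congr rfl fun i _ => ?_
    split_ifs
    exacts [(h.length_eq i).symm, rfl]
  count_eq w := by
    rw [← h.count_eq w]
    refine Finset.sum_congr rfl fun i _ => ?_
    split_ifs
    exacts [h.count_add_tail i w, rfl]

/-- Changing from one arc to the other along the connection, in either direction, and closing up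
through the remaining arcs of `A` gives two cycles. Together they have `2 * N + 2 * (r.length + 1)`
vertices. -/
theorem not_joined_parallel_zero (h : ParallelCycles G N U x A B) (hN : CircumferenceLE G N) :
    ¬ Joined G U (A 0).tail (B 0).tail := by
  rintro ⟨s, hs, t, ht, r, hr, hU⟩
  obtain ⟨hA, hB⟩ := h.left_eq (List.ne_nil_of_mem hs)
  obtain ⟨l₁, l₂, hl⟩ := List.append_of_mem hs
  obtain ⟨m₁, m₂, hm⟩ := List.append_of_mem ht
  rw [hl] at hA
  rw [hm] at hB
  have a0 := h.strand_left 0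
  have b0 := h.strand_right 0
  have hlen := h.length_eq 0
  have hsum := h.length_sum
  have hcount := h.count_eq
  simp only [Fin.sum_univ_four, hm] at hsum hcount
  rw [hA] at a0 hlen hsum
  rw [hB] at b0 hlen
  simp only [hA] at hcount
  have hK := ((h.strand_left 1).append (h.strand_left 2)).append (h.strand_left 3)
  have a := (List.cons_append ▸ a0 : Strand G (x 0) ((x 0 :: l₁) ++ s :: l₂) (x 1)).split
  have b := (List.cons_append ▸ b0 : Strand G (x 0) ((x 0 :: m₁) ++ t :: m₂) (x 1)).split
  have c1 := hN _ _ (((a.1.append hr).append b.2).append hK) (by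
    refine List.nodup_iff_count_le_one.2 fun w => ?_
    have h1 := hcount w
    have h2 := hU w
    simp only [List.count_append, count_cons_eq] at h1 ⊢
    omega)
  have c2 := hN _ _ (((b.1.append hr.reverse).append a.2).append hK) (by
    refine List.nodup_iff_count_le_one.2 fun w => ?_
    have h1 := hcount w
    have h2 := hU w
    simp only [List.count_append, count_cons_eq, List.count_reverse] at h1 ⊢
    omega)
  simp only [List.length_append, List.length_cons, List.length_reverse] at c1 c2 hlen hsum
  omega

theorem not_joined_parallel (h : ParallelCycles G N U x A B) (hN : CircumferenceLE G N)
    (i : Fin 4) : ¬ Joined G U (A i).tail (B i).tail := by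
  simpa using (h.rotate i).not_joined_parallel_zero hN

/-- One cycle crosses from `A 0` to `A 1`, returns to `x 1` and goes on along `B 1`. The other
reaches `x 1` along `B 0`, goes back on `A 0` and crosses to `A 1`. Together they use the four arcs
once, the other two positions twice and the connection twice. -/
theorem not_joined_adjacent_zero (h : ParallelCycles G N U x A B) (hN : CircumferenceLE G N) :
    ¬ Joined G U (A 0).tail (A 1).tail := by
  rintro ⟨s, hs, t, ht, r, hr, hU⟩
  obtain ⟨hA, hB⟩ := h.left_eq (List.ne_nil_of_mem hs)
  obtain ⟨hA', hB'⟩ := h.left_eq (List.ne_nil_of_mem ht)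
  obtain ⟨l₁, l₂, hl⟩ := List.append_of_mem hs
  obtain ⟨m₁, m₂, hm⟩ := List.append_of_mem ht
  rw [hl] at hA
  rw [hm] at hA'
  have a0 := h.strand_left 0
  have b0 := h.strand_right 0
  have a1 := h.strand_left 1
  have b1 := h.strand_right 1
  have hlen := h.length_eq 0
  have hlen' := h.length_eq 1
  have hsum := h.length_sum
  have hcount := h.count_eq
  simp only [Fin.sum_univ_four] at hsum hcount
  rw [hA] at a0 hlen hsum
  rw [hA'] at a1 hlen' hsum
  rw [hB] at b0 hlen
  rw [hB'] at b1 hlen'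
  simp only [hA, hA'] at hcount
  have hK := (h.strand_left 2).append (h.strand_left 3)
  have a := (List.cons_append ▸ a0 : Strand G (x 0) ((x 0 :: l₁) ++ s :: l₂) (x 1)).split
  have a' := (List.cons_append ▸ a1 : Strand G (x 1) ((x 1 :: m₁) ++ t :: m₂) (x 2)).split
  have c1 := hN _ _ ((((a.1.append hr).append a'.1.reverse).append b1).append hK) (by
    refine List.nodup_iff_count_le_one.2 fun w => ?_
    have h1 := hcount w
    have h2 := hU w
    simp only [List.count_append, count_cons_eq, List.count_reverse] at h1 ⊢
    omega)
  have c2 := hN _ _ ((((b0.append a.2.reverse).append hr).append a'.2).append hK) (by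
    refine List.nodup_iff_count_le_one.2 fun w => ?_
    have h1 := hcount w
    have h2 := hU w
    simp only [List.count_append, count_cons_eq, List.count_reverse] at h1 ⊢
    omega)
  simp only [List.length_append, List.length_cons, List.length_reverse] at c1 c2 hlen hlen' hsum
  omega

theorem not_joined_adjacent (h : ParallelCycles G N U x A B) (hN : CircumferenceLE G N)
    (i : Fin 4) : ¬ Joined G U (A i).tail (A (i + 1)).tail := by
  simpa [add_comm] using (h.rotate i).not_joined_adjacent_zero hN

/-- The inner vertices of the `i`-th arcs of both cycles. -/
def inner (A B : Fin 4 → List W) (i : Fin 4) : List W := (A i).tail ++ (B i).tail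

theorem not_joined_inner_succ (h : ParallelCycles G N U x A B) (hN : CircumferenceLE G N)
    (i : Fin 4) : ¬ Joined G U (inner A B i) (inner A B (i + 1)) := by
  rintro ⟨s, hs, t, ht, r, hr⟩
  have hi : i + 1 ≠ i := by simp
  rcases List.mem_append.1 hs with hs | hs <;> rcases List.mem_append.1 ht with ht | ht
  · exact h.not_joined_adjacent hN i ⟨s, hs, t, ht, r, hr⟩
  · exact (h.exchange fun j => decide (j = i + 1)).not_joined_adjacent hN i
      ⟨s, by simpa [hi.symm] using hs, t, by simpa using ht, r, hr⟩
  · exact (h.exchange fun j => decide (j = i)).not_joined_adjacent hN i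
      ⟨s, by simpa using hs, t, by simpa [hi] using ht, r, hr⟩
  · exact (h.exchange fun _ => true).not_joined_adjacent hN i
      ⟨s, by simpa using hs, t, by simpa using ht, r, hr⟩

/-- An empty arc can be moved to the last position, which turns the opposite positions `0` and `2`
into adjacent ones. -/
theorem collapse (h : ParallelCycles G N U x A B) (h1 : A 1 = []) :
    ParallelCycles G N U ![x 0, x 2, x 3, x 0] ![A 0, A 2, A 3, []] ![B 0, B 2, B 3, []] := by
  have h1' : B 1 = [] := List.length_eq_zero_iff.1 (by rw [← h.length_eq 1, h1]; rfl)
  have hx : x 1 = x 2 := Strand.nil_iff.1 (h1 ▸ h.strand_left 1)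
  have hsum := h.length_sum
  have hcount := h.count_eq
  simp only [Fin.sum_univ_four, h1, h1'] at hsum hcount
  refine ⟨fun i => ?_, fun i => ?_, fun i => ?_, ?_, fun w => ?_⟩
  · fin_cases i
    exacts [hx ▸ h.strand_left 0, h.strand_left 2, h.strand_left 3, .nil _]
  · fin_cases i
    exacts [hx ▸ h.strand_right 0, h.strand_right 2, h.strand_right 3, .nil _]
  · fin_cases i
    exacts [h.length_eq 0, h.length_eq 2, h.length_eq 3, rfl]
  · rw [← hsum]; simp [Fin.sum_univ_four]
  · rw [← hcount w]; simp [Fin.sum_univ_four]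

/-- If `A 1` is empty, the joined arcs are in fact adjacent. If it is a single edge, the detour
through the connection replaces this edge by something longer. -/
theorem ne_nil_of_joined_opposite_zero (h : ParallelCycles G N U x A B)
    (hN : CircumferenceLE G N) (hj : Joined G U (A 0).tail (B 2).tail) :
    (A 1).tail ≠ [] := by
  have h1 : A 1 ≠ [] := fun h1 => (h.collapse h1).not_joined_inner_succ hN 0 <|
    hj.of_mem (fun y hy => List.mem_append_left _ hy) fun y hy => List.mem_append_right _ hy
  obtain ⟨y, l, hl⟩ := List.exists_cons_of_ne_nil h1
  obtain rfl := (hl ▸ h.strand_left 1).eq_cons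
  obtain ⟨s, hs, t, ht, r, hr, hU⟩ := hj
  obtain ⟨hA, hB⟩ := h.left_eq (List.ne_nil_of_mem hs)
  have hB2 : (A 2).tail ≠ [] := fun h2 => by
    have := congrArg List.length h2
    rw [List.length_tail, h.length_eq 2, ← List.length_tail] at this
    exact List.ne_nil_of_mem ht (List.length_eq_zero_iff.1 this)
  obtain ⟨hA', hB'⟩ := h.left_eq hB2
  obtain ⟨l₁, l₂, hl'⟩ := List.append_of_mem hs
  obtain ⟨m₁, m₂, hm⟩ := List.append_of_mem ht
  rw [hl'] at hA
  have a0 := h.strand_left 0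
  have b0 := h.strand_right 0
  have b2 := h.strand_right 2
  have hlen := h.length_eq 0
  have hsum := h.length_sum
  have hcount := h.count_eq
  simp only [Fin.sum_univ_four] at hsum hcount
  rw [hA] at a0 hlen hsum
  rw [hB] at b0 hlen
  rw [hB', hm] at b2
  rw [hl] at hsum
  simp only [hA, hl, hm] at hcount
  have a := (List.cons_append ▸ a0 : Strand G (x 0) ((x 0 :: l₁) ++ s :: l₂) (x 1)).split
  have b := (List.cons_append ▸ b2 : Strand G (x 2) ((x 2 :: m₁) ++ t :: m₂) (x 3)).split
  -- Along `B 0` to `x 1`, back on `A 0` to `s`, across to `t`, back on `B 2` to `x 2`, then home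
  -- along `A 2` and `A 3`: only `A 1` is bypassed.
  have c := hN _ _ (((((b0.append a.2.reverse).append hr).append b.1.reverse).append
    (h.strand_left 2)).append (h.strand_left 3)) (by
    refine List.nodup_iff_count_le_one.2 fun w => ?_
    have h1 := hcount w
    have h2 := hU w
    simp only [List.count_append, count_cons_eq, List.count_reverse] at h1 ⊢
    omega)
  simp only [List.length_append, List.length_cons, List.length_reverse] at c hlen hsum
  intro h0
  rw [hl, List.tail_cons] at h0
  simp only [h0, List.length_nil] at hsum
  omega

theorem ne_nil_of_joined_opposite (h : ParallelCycles G N U x A B) (hN : CircumferenceLE G N)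
    (i : Fin 4) (hj : Joined G U (A i).tail (B (i + 2)).tail) : (A (i + 1)).tail ≠ [] := by
  simpa [add_comm] using (h.rotate i).ne_nil_of_joined_opposite_zero hN
    (by simpa [add_comm] using hj)

theorem exists_mem_of_ne_zero (h : ParallelCycles G N U x A B) {w : W} (hw : U w ≠ 0) :
    (∃ i, w = x i) ∨ (∃ i, w ∈ (A i).tail) ∨ ∃ i, w ∈ (B i).tail := by
  rw [← h.count_eq w] at hw
  obtain ⟨i, -, hi⟩ := Finset.exists_ne_zero_of_sum_ne_zero hw
  rcases Nat.add_eq_zero_iff.not.1 hi |> not_and_or.1 with hi | hi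
  · have hm : w ∈ A i := List.count_pos_iff.1 (Nat.pos_of_ne_zero hi)
    match hA : A i with
    | [] => simp [hA] at hm
    | a :: l =>
      obtain rfl := (hA ▸ h.strand_left i).eq_cons
      rw [hA] at hm
      rcases List.mem_cons.1 hm with hm | hm
      · exact .inl ⟨i, hm⟩
      · exact .inr (.inl ⟨i, by rw [hA]; exact hm⟩)
  · exact .inr (.inr ⟨i, List.count_pos_iff.1 (Nat.pos_of_ne_zero hi)⟩)

end ParallelCycles

/-! ### Connections outside the common vertices -/

/-- Any two vertices outside `X` are connected by a path outside `X`. -/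
def ConnectedOff (G : SimpleGraph W) (X : Set W) : Prop :=
  ∀ u v : W, u ∉ X → v ∉ X → ∃ l : List W, Strand G u l v ∧ l.Nodup ∧ ∀ w ∈ l, w ∉ X

/-- A connection taken shortest avoids `S` and `T` in its interior. As `X`, `S` and `T` cover the
support of `U`, its interior has `U` equal to zero. -/
theorem ConnectedOff.exists_strand [DecidableEq W] {X S T : Set W} (h : ConnectedOff G X)
    {U : W → ℕ} (hU : ∀ w, U w ≤ 1) (hUX : ∀ w, U w ≠ 0 → w ∈ X ∨ w ∈ S ∨ w ∈ T)
    (hST : ∀ w ∈ S, w ∉ T) (hSX : ∀ w ∈ S, w ∉ X) (hTX : ∀ w ∈ T, w ∉ X)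
    (hS : S.Nonempty) (hT : T.Nonempty) :
    ∃ s ∈ S, ∃ t ∈ T, ∃ r : List W, Strand G s (s :: r) t ∧ ∀ w, r.count w + U w ≤ 1 := by
  obtain ⟨u, hu⟩ := hS
  obtain ⟨v, hv⟩ := hT
  obtain ⟨l, hl, hn, hX⟩ := h u v (hSX u hu) (hTX v hv)
  obtain ⟨s, hs, t, ht, r, hr, hrn, hrU⟩ :=
    hl.exists_connection hn (Set.disjoint_left.2 fun w hw => hST w hw) hu hv hX
  refine ⟨s, hs, t, ht, r, hr, fun w => ?_⟩
  have h1 := List.nodup_iff_count_le_one.1 hrn w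
  have h2 := hU w
  by_cases hw : w ∈ r
  · have : U w = 0 := by
      by_contra h0
      have := hrU w hw
      have := hUX w h0
      tauto
    omega
  · rw [List.count_eq_zero_of_not_mem hw]; omega

namespace ParallelCycles

variable [DecidableEq W] {N : ℕ} {U : W → ℕ} {x : Fin 4 → W} {A B : Fin 4 → List W}

theorem tail_disjoint (h : ParallelCycles G N U x A B) (hU : ∀ w, U w ≤ 1) {i j : Fin 4} {w : W}
    (hi : w ∈ (A i).tail) (hj : w ∈ (B j).tail) : False := by
  have h1 := h.count_eq w
  rw [Finset.sum_add_distrib] at h1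
  have h2 := Finset.single_le_sum (f := fun i => (A i).count w) (fun _ _ => Nat.zero_le _)
    (Finset.mem_univ i)
  have h3 := Finset.single_le_sum (f := fun i => (B i).tail.count w) (fun _ _ => Nat.zero_le _)
    (Finset.mem_univ j)
  have h4 := List.count_pos_iff.2 (List.mem_of_mem_tail hi)
  have h5 := List.count_pos_iff.2 hj
  have h6 := hU w
  omega

theorem inner_disjoint (h : ParallelCycles G N U x A B) (hU : ∀ w, U w ≤ 1) {i j : Fin 4}
    (hij : i ≠ j) {w : W} (hi : w ∈ inner A B i) (hj : w ∈ inner A B j) : False := by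
  have h1 := h.count_eq w
  have h2 := Finset.sum_le_sum_of_subset (f := fun i => (A i).count w + (B i).tail.count w)
    (Finset.subset_univ {i, j})
  rw [Finset.sum_pair hij] at h2
  have key : ∀ k, w ∈ inner A B k → 0 < (A k).count w + (B k).tail.count w := fun k hk => by
    rcases List.mem_append.1 hk with hk | hk
    · have := List.count_pos_iff.2 (List.mem_of_mem_tail hk); omega
    · have := List.count_pos_iff.2 hk; omega
  have h3 := key i hi
  have h4 := key j hj
  have h5 := hU w
  omega

theorem tail_ne_nil_iff (h : ParallelCycles G N U x A B) (i : Fin 4) :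
    (A i).tail ≠ [] ↔ (B i).tail ≠ [] := by
  have := h.length_eq i
  rw [← List.length_pos_iff, ← List.length_pos_iff, List.length_tail, List.length_tail, this]

/-- Longest cycles meeting in at most four vertices, in the same cyclic order: the common vertices
separate the graph. -/
theorem not_connectedOff (h : ParallelCycles G N U x A B) (hN : CircumferenceLE G N)
    (hU : ∀ w, U w ≤ 1) {X : Set W} (hx : ∀ i, x i ∈ X) (hA : ∀ i, ∀ w ∈ (A i).tail, w ∉ X)
    (hB : ∀ i, ∀ w ∈ (B i).tail, w ∉ X) (hne : ∃ i, (A i).tail ≠ []) :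
    ¬ ConnectedOff G X := by
  intro hX
  obtain ⟨i₀, hi₀⟩ := hne
  -- First connection: from the inner vertices of one cycle to those of the other. Only opposite
  -- positions survive.
  obtain ⟨s, ⟨i, hs⟩, t, ⟨j, ht⟩, r, hr⟩ := hX.exists_strand (S := {w | ∃ i, w ∈ (A i).tail})
    (T := {w | ∃ i, w ∈ (B i).tail}) hU
    (fun w hw => by
      rcases h.exists_mem_of_ne_zero hw with ⟨i, rfl⟩ | hw | hw
      exacts [.inl (hx i), .inr (.inl hw), .inr (.inr hw)])
    (fun w ⟨i, hi⟩ ⟨j, hj⟩ => h.tail_disjoint hU hi hj)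
    (fun w ⟨i, hi⟩ => hA i w hi) (fun w ⟨i, hi⟩ => hB i w hi)
    ((List.exists_mem_of_ne_nil _ hi₀).imp fun w hw => ⟨i₀, hw⟩)
    ((List.exists_mem_of_ne_nil _ ((h.tail_ne_nil_iff i₀).1 hi₀)).imp fun w hw => ⟨i₀, hw⟩)
  have hJ : Joined G U (A i).tail (B j).tail := ⟨s, hs, t, ht, r, hr⟩
  have hJ' : Joined G U (inner A B i) (inner A B j) :=
    hJ.of_mem (fun y hy => List.mem_append_left _ hy) fun y hy => List.mem_append_right _ hy
  have hj : j = i ∨ j = i + 1 ∨ i = j + 1 ∨ j = i + 2 := by clear * -; revert i j; decide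
  obtain rfl | rfl | rfl | rfl := hj
  · exact h.not_joined_parallel hN _ hJ
  · exact h.not_joined_inner_succ hN _ hJ'
  · exact h.not_joined_inner_succ hN _ hJ'.symm
  have h1 := h.ne_nil_of_joined_opposite hN i hJ
  have hcase : ∀ k, k = i ∨ k = i + 2 ∨ k = i + 1 ∨ k = i + 3 := by clear * -; revert i; decide
  -- Second connection: from positions `i`, `i + 2` to positions `i + 1`, `i + 3`, where `h1`
  -- provides an inner vertex on the latter side. Any such two positions are adjacent.
  obtain ⟨s, ⟨j, hj, hs⟩, t, ⟨k, hk, ht⟩, r, hr⟩ := hX.exists_strand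
    (S := {w | ∃ j, (j = i ∨ j = i + 2) ∧ w ∈ inner A B j})
    (T := {w | ∃ j, (j = i + 1 ∨ j = i + 3) ∧ w ∈ inner A B j}) hU
    (fun w hw => by
      have key : ∀ k, w ∈ inner A B k → w ∈ {w | ∃ j, (j = i ∨ j = i + 2) ∧ w ∈ inner A B j} ∨
          w ∈ {w | ∃ j, (j = i + 1 ∨ j = i + 3) ∧ w ∈ inner A B j} := fun k hk => by
        rcases hcase k with hc | hc | hc | hc
        exacts [.inl ⟨k, .inl hc, hk⟩, .inl ⟨k, .inr hc, hk⟩, .inr ⟨k, .inl hc, hk⟩,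
          .inr ⟨k, .inr hc, hk⟩]
      rcases h.exists_mem_of_ne_zero hw with ⟨i, rfl⟩ | ⟨k, hw⟩ | ⟨k, hw⟩
      exacts [.inl (hx i), .inr (key k (List.mem_append_left _ hw)),
        .inr (key k (List.mem_append_right _ hw))])
    (fun w ⟨j, hj, hwj⟩ ⟨k, hk, hwk⟩ => h.inner_disjoint hU
      (by clear * - hj hk; revert i j k; decide) hwj hwk)
    (fun w ⟨j, _, hj⟩ => (List.mem_append.1 hj).elim (hA j w) (hB j w))
    (fun w ⟨j, _, hj⟩ => (List.mem_append.1 hj).elim (hA j w) (hB j w))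
    ⟨s, i, .inl rfl, List.mem_append_left _ hs⟩
    ((List.exists_mem_of_ne_nil _ h1).imp
      fun w hw => ⟨i + 1, .inl rfl, List.mem_append_left _ hw⟩)
  have hJ : Joined G U (inner A B j) (inner A B k) := ⟨s, hs, t, ht, r, hr⟩
  have : k = j + 1 ∨ j = k + 1 := by clear * - hj hk; revert i j k; decide
  obtain rfl | rfl := this
  · exact h.not_joined_inner_succ hN _ hJ
  · exact h.not_joined_inner_succ hN _ hJ.symm

end ParallelCycles

/-! ### Longest cycles with different cyclic orders of four common vertices -/

/-- Two cycles of length `N` that run through their common vertices in the orders `x₀ x₁ x₂ x₃` and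
`x₀ x₁ x₃ x₂`. The arcs `a`, `a'` join `x₀` to `x₁`, the arcs `c`, `c'` join `x₂` to `x₃`. -/
structure TwistedCycles [DecidableEq W] (G : SimpleGraph W) (N : ℕ) (U : W → ℕ)
    (x₀ x₁ x₂ x₃ : W) (a a' c c' e f g h : List W) : Prop where
  strand_a : Strand G x₀ (x₀ :: a) x₁
  strand_a' : Strand G x₀ (x₀ :: a') x₁
  strand_c : Strand G x₂ (x₂ :: c) x₃
  strand_c' : Strand G x₂ (x₂ :: c') x₃
  strand_e : Strand G x₁ (x₁ :: e) x₂
  strand_f : Strand G x₃ (x₃ :: f) x₀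
  strand_g : Strand G x₁ (x₁ :: g) x₃
  strand_h : Strand G x₂ (x₂ :: h) x₀
  length_a : a.length = a'.length
  length_c : c.length = c'.length
  length_left : a.length + c.length + e.length + f.length + 4 = N
  length_right : a.length + c.length + g.length + h.length + 4 = N
  count_eq : ∀ w, vertexIndicator x₀ w + vertexIndicator x₁ w + vertexIndicator x₂ w +
    vertexIndicator x₃ w + a.count w + a'.count w + c.count w + c'.count w + e.count w +
    f.count w + g.count w + h.count w = U w

namespace TwistedCycles

variable [DecidableEq W] {N : ℕ} {U : W → ℕ} {x₀ x₁ x₂ x₃ : W} {a a' c c' e f g h : List W}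

theorem exchange_a (T : TwistedCycles G N U x₀ x₁ x₂ x₃ a a' c c' e f g h) :
    TwistedCycles G N U x₀ x₁ x₂ x₃ a' a c c' e f g h :=
  { T with
    strand_a := T.strand_a'
    strand_a' := T.strand_a
    length_a := T.length_a.symm
    length_left := T.length_a ▸ T.length_left
    length_right := T.length_a ▸ T.length_right
    count_eq := fun w => by rw [← T.count_eq w]; omega }

theorem exchange_c (T : TwistedCycles G N U x₀ x₁ x₂ x₃ a a' c c' e f g h) :
    TwistedCycles G N U x₀ x₁ x₂ x₃ a a' c' c e f g h :=
  { T with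
    strand_c := T.strand_c'
    strand_c' := T.strand_c
    length_c := T.length_c.symm
    length_left := T.length_c ▸ T.length_left
    length_right := T.length_c ▸ T.length_right
    count_eq := fun w => by rw [← T.count_eq w]; omega }

/-- Renaming `x₂` and `x₃` into each other interchanges the roles of the two cycles. -/
theorem flip_right (T : TwistedCycles G N U x₀ x₁ x₂ x₃ a a' c c' e f g h) :
    TwistedCycles G N U x₀ x₁ x₃ x₂ a a' c.reverse c'.reverse g h e f where
  strand_a := T.strand_a
  strand_a' := T.strand_a'
  strand_c := T.strand_c.reverse
  strand_c' := T.strand_c'.reverse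
  strand_e := T.strand_g
  strand_f := T.strand_h
  strand_g := T.strand_e
  strand_h := T.strand_f
  length_a := T.length_a
  length_c := by simpa using T.length_c
  length_left := by simpa using T.length_right
  length_right := by simpa using T.length_left
  count_eq w := by simp only [List.count_reverse, ← T.count_eq w]; omega

/-- The left cycle is started at `x₂` and the right one is also reversed; this interchanges the
pairs `a`, `a'` and `c`, `c'`. -/
theorem rotate (T : TwistedCycles G N U x₀ x₁ x₂ x₃ a a' c c' e f g h) :
    TwistedCycles G N U x₂ x₃ x₀ x₁ c c' a a' f e g.reverse h.reverse where
  strand_a := T.strand_c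
  strand_a' := T.strand_c'
  strand_c := T.strand_a
  strand_c' := T.strand_a'
  strand_e := T.strand_f
  strand_f := T.strand_e
  strand_g := T.strand_g.reverse
  strand_h := T.strand_h.reverse
  length_a := T.length_c
  length_c := T.length_a
  length_left := by have := T.length_left; omega
  length_right := by have := T.length_right; simp only [List.length_reverse]; omega
  count_eq w := by simp only [List.count_reverse, ← T.count_eq w]; omega

/-- Renaming `x₀` and `x₁` into each other likewise interchanges the two cycles. With the other
symmetries it reduces all pairs of arcs to four cases. -/
theorem flip_left (T : TwistedCycles G N U x₀ x₁ x₂ x₃ a a' c c' e f g h) :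
    TwistedCycles G N U x₁ x₀ x₂ x₃ a.reverse a'.reverse c c' h.reverse g.reverse f.reverse
      e.reverse where
  strand_a := T.strand_a.reverse
  strand_a' := T.strand_a'.reverse
  strand_c := T.strand_c
  strand_c' := T.strand_c'
  strand_e := T.strand_h.reverse
  strand_f := T.strand_g.reverse
  strand_g := T.strand_f.reverse
  strand_h := T.strand_e.reverse
  length_a := by simpa using T.length_a
  length_c := T.length_c
  length_left := by have := T.length_right; simp only [List.length_reverse]; omega
  length_right := by have := T.length_left; simp only [List.length_reverse]; omega
  count_eq w := by simp only [List.count_reverse, ← T.count_eq w]; omega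

theorem not_joined_a_a' (T : TwistedCycles G N U x₀ x₁ x₂ x₃ a a' c c' e f g h)
    (hN : CircumferenceLE G N) : ¬ Joined G U a a' := by
  rintro ⟨s, hs, t, ht, r, hr, hU⟩
  obtain ⟨l₁, l₂, rfl⟩ := List.append_of_mem hs
  obtain ⟨m₁, m₂, rfl⟩ := List.append_of_mem ht
  have hs := (List.cons_append ▸ T.strand_a : Strand G x₀ ((x₀ :: l₁) ++ s :: l₂) x₁).split
  have ht := (List.cons_append ▸ T.strand_a' : Strand G x₀ ((x₀ :: m₁) ++ t :: m₂) x₁).split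
  have hK := (T.strand_e.append T.strand_c).append T.strand_f
  have c1 := hN _ _ (((hs.1.append hr).append ht.2).append hK) (by
    refine List.nodup_iff_count_le_one.2 fun w => ?_
    have h1 := T.count_eq w
    have h2 := hU w
    simp only [List.count_append, count_cons_eq] at h1 ⊢
    omega)
  have c2 := hN _ _ (((ht.1.append hr.reverse).append hs.2).append hK) (by
    refine List.nodup_iff_count_le_one.2 fun w => ?_
    have h1 := T.count_eq w
    have h2 := hU w
    simp only [List.count_append, count_cons_eq, List.count_reverse] at h1 ⊢
    omega)
  have h1 := T.length_a
  have h2 := T.length_left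
  simp only [List.length_append, List.length_cons, List.length_reverse] at c1 c2 h1 h2
  omega

/-- Crossing from `a` to `c`, one cycle closes up through `e`, `g`, `f` and the other through `a'`,
`c'`, `h`. Together they use all eight arcs exactly once and the connection twice. -/
theorem not_joined_a_c (T : TwistedCycles G N U x₀ x₁ x₂ x₃ a a' c c' e f g h)
    (hN : CircumferenceLE G N) : ¬ Joined G U a c := by
  rintro ⟨s, hs, t, ht, r, hr, hU⟩
  obtain ⟨l₁, l₂, rfl⟩ := List.append_of_mem hs
  obtain ⟨m₁, m₂, rfl⟩ := List.append_of_mem ht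
  have hs := (List.cons_append ▸ T.strand_a : Strand G x₀ ((x₀ :: l₁) ++ s :: l₂) x₁).split
  have ht := (List.cons_append ▸ T.strand_c : Strand G x₂ ((x₂ :: m₁) ++ t :: m₂) x₃).split
  have c1 := hN _ _ (((((hs.1.append hr).append ht.1.reverse).append T.strand_e.reverse).append
    T.strand_g).append T.strand_f) (by
    refine List.nodup_iff_count_le_one.2 fun w => ?_
    have h1 := T.count_eq w
    have h2 := hU w
    simp only [List.count_append, count_cons_eq, List.count_reverse] at h1 ⊢
    omega)
  have c2 := hN _ _ (((((T.strand_a'.append hs.2.reverse).append hr).append ht.2).append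
    T.strand_c'.reverse).append T.strand_h) (by
    refine List.nodup_iff_count_le_one.2 fun w => ?_
    have h1 := T.count_eq w
    have h2 := hU w
    simp only [List.count_append, count_cons_eq, List.count_reverse] at h1 ⊢
    omega)
  have h1 := T.length_a
  have h2 := T.length_c
  have h3 := T.length_left
  have h4 := T.length_right
  simp only [List.length_append, List.length_cons, List.length_reverse] at c1 c2 h1 h2 h3 h4
  omega

/-- The two cycles through the connection are completed by `g`, `c`, `h` and by `a'`, `c`, `f`.
Using `c` twice costs nothing, as `c` and `c'` are equally long. -/
theorem not_joined_a_e (T : TwistedCycles G N U x₀ x₁ x₂ x₃ a a' c c' e f g h)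
    (hN : CircumferenceLE G N) : ¬ Joined G U a e := by
  rintro ⟨s, hs, t, ht, r, hr, hU⟩
  obtain ⟨l₁, l₂, rfl⟩ := List.append_of_mem hs
  obtain ⟨m₁, m₂, rfl⟩ := List.append_of_mem ht
  have hs := (List.cons_append ▸ T.strand_a : Strand G x₀ ((x₀ :: l₁) ++ s :: l₂) x₁).split
  have ht := (List.cons_append ▸ T.strand_e : Strand G x₁ ((x₁ :: m₁) ++ t :: m₂) x₂).split
  have c1 := hN _ _ (((((hs.1.append hr).append ht.1.reverse).append T.strand_g).append
    T.strand_c.reverse).append T.strand_h) (by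
    refine List.nodup_iff_count_le_one.2 fun w => ?_
    have h1 := T.count_eq w
    have h2 := hU w
    simp only [List.count_append, count_cons_eq, List.count_reverse] at h1 ⊢
    omega)
  have c2 := hN _ _ (((((T.strand_a'.append hs.2.reverse).append hr).append ht.2).append
    T.strand_c).append T.strand_f) (by
    refine List.nodup_iff_count_le_one.2 fun w => ?_
    have h1 := T.count_eq w
    have h2 := hU w
    simp only [List.count_append, count_cons_eq, List.count_reverse] at h1 ⊢
    omega)
  have h1 := T.length_a
  have h3 := T.length_left
  have h4 := T.length_right
  simp only [List.length_append, List.length_cons, List.length_reverse] at c1 c2 h1 h3 h4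
  omega

/-- The connection allows a change between `e` and `g` in both directions; each of the two resulting
cycles contains `a` and `c`. -/
theorem not_joined_e_g (T : TwistedCycles G N U x₀ x₁ x₂ x₃ a a' c c' e f g h)
    (hN : CircumferenceLE G N) : ¬ Joined G U e g := by
  rintro ⟨s, hs, t, ht, r, hr, hU⟩
  obtain ⟨l₁, l₂, rfl⟩ := List.append_of_mem hs
  obtain ⟨m₁, m₂, rfl⟩ := List.append_of_mem ht
  have hs := (List.cons_append ▸ T.strand_e : Strand G x₁ ((x₁ :: l₁) ++ s :: l₂) x₂).split
  have ht := (List.cons_append ▸ T.strand_g : Strand G x₁ ((x₁ :: m₁) ++ t :: m₂) x₃).split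
  have c1 := hN _ _ (((((T.strand_a.append hs.1).append hr).append ht.2).append
    T.strand_c.reverse).append T.strand_h) (by
    refine List.nodup_iff_count_le_one.2 fun w => ?_
    have h1 := T.count_eq w
    have h2 := hU w
    simp only [List.count_append, count_cons_eq, List.count_reverse] at h1 ⊢
    omega)
  have c2 := hN _ _ (((((T.strand_a.append ht.1).append hr.reverse).append hs.2).append
    T.strand_c).append T.strand_f) (by
    refine List.nodup_iff_count_le_one.2 fun w => ?_
    have h1 := T.count_eq w
    have h2 := hU w
    simp only [List.count_append, count_cons_eq, List.count_reverse] at h1 ⊢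
    omega)
  have h3 := T.length_left
  have h4 := T.length_right
  simp only [List.length_append, List.length_cons, List.length_reverse] at c1 c2 h3 h4
  omega

theorem not_joined_a (T : TwistedCycles G N U x₀ x₁ x₂ x₃ a a' c c' e f g h)
    (hN : CircumferenceLE G N) : ¬ Joined G U a e ∧ ¬ Joined G U a f ∧ ¬ Joined G U a g ∧
      ¬ Joined G U a h :=
  ⟨T.not_joined_a_e hN,
    fun hj => T.flip_right.flip_left.not_joined_a_e hN (hj.of_mem (by simp) (by simp)),
    T.flip_right.not_joined_a_e hN,
    fun hj => T.flip_left.not_joined_a_e hN (hj.of_mem (by simp) (by simp))⟩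

theorem not_joined (T : TwistedCycles G N U x₀ x₁ x₂ x₃ a a' c c' e f g h)
    (hN : CircumferenceLE G N) {l m : List W} (hl : l = a ∨ l = e ∨ l = c ∨ l = f)
    (hm : m = a' ∨ m = g ∨ m = c' ∨ m = h) : ¬ Joined G U l m := by
  intro hj
  rcases hl with rfl | rfl | rfl | rfl <;> rcases hm with rfl | rfl | rfl | rfl
  · exact T.not_joined_a_a' hN hj
  · exact (T.not_joined_a hN).2.2.1 hj
  · exact T.exchange_c.not_joined_a_c hN hj
  · exact (T.not_joined_a hN).2.2.2 hj
  · exact (T.exchange_a.not_joined_a hN).1 hj.symm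
  · exact T.not_joined_e_g hN hj
  · exact (T.exchange_c.rotate.not_joined_a hN).2.1 hj.symm
  · exact T.rotate.flip_left.not_joined_e_g hN (hj.symm.of_mem (by simp) (by simp))
  · exact T.exchange_a.not_joined_a_c hN hj.symm
  · exact (T.rotate.not_joined_a hN).2.2.1 (hj.of_mem (by simp) (by simp))
  · exact T.rotate.not_joined_a_a' hN hj
  · exact (T.rotate.not_joined_a hN).2.2.2 (hj.of_mem (by simp) (by simp))
  · exact (T.exchange_a.not_joined_a hN).2.1 hj.symm
  · exact T.rotate.not_joined_e_g hN (hj.of_mem (by simp) (by simp))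
  · exact (T.exchange_c.rotate.not_joined_a hN).1 hj.symm
  · exact T.flip_left.not_joined_e_g hN (hj.symm.of_mem (by simp) (by simp))

/-- Longest cycles meeting in four vertices, in different cyclic orders: the common vertices
separate the graph. -/
theorem not_connectedOff (T : TwistedCycles G N U x₀ x₁ x₂ x₃ a a' c c' e f g h)
    (hN : CircumferenceLE G N) (hU : ∀ w, U w ≤ 1) {X : Set W} (h0 : x₀ ∈ X) (h1 : x₁ ∈ X)
    (h2 : x₂ ∈ X) (h3 : x₃ ∈ X) (hX₁ : ∀ w, w ∈ a ∨ w ∈ e ∨ w ∈ c ∨ w ∈ f → w ∉ X)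
    (hX₂ : ∀ w, w ∈ a' ∨ w ∈ g ∨ w ∈ c' ∨ w ∈ h → w ∉ X)
    (hd : ∀ w, (w ∈ a ∨ w ∈ e ∨ w ∈ c ∨ w ∈ f) → (w ∈ a' ∨ w ∈ g ∨ w ∈ c' ∨ w ∈ h) → w ∈ X)
    (h4 : 4 < N) : ¬ ConnectedOff G X := by
  intro hX
  have hll := T.length_left
  have hlr := T.length_right
  have hla := T.length_a
  have hlc := T.length_c
  -- Because `4 < N`, each cycle has a vertex besides the four common ones, so both ends of the
  -- connection have somewhere to start.
  have hne : ∀ {p q r s : List W}, p.length + q.length + r.length + s.length ≠ 0 →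
      {w | w ∈ p ∨ w ∈ q ∨ w ∈ r ∨ w ∈ s}.Nonempty := fun {p q r s} hn => by
    by_contra h0
    simp only [Set.not_nonempty_iff_eq_empty, Set.eq_empty_iff_forall_notMem, Set.mem_ofPred_eq,
      not_or] at h0
    have e1 := List.eq_nil_iff_forall_not_mem.2 fun w => (h0 w).1
    have e2 := List.eq_nil_iff_forall_not_mem.2 fun w => (h0 w).2.1
    have e3 := List.eq_nil_iff_forall_not_mem.2 fun w => (h0 w).2.2.1
    have e4 := List.eq_nil_iff_forall_not_mem.2 fun w => (h0 w).2.2.2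
    simp [e1, e2, e3, e4] at hn
  obtain ⟨s, hs, t, ht, r, hr⟩ := hX.exists_strand (U := U)
    (S := {w | w ∈ a ∨ w ∈ e ∨ w ∈ c ∨ w ∈ f}) (T := {w | w ∈ a' ∨ w ∈ g ∨ w ∈ c' ∨ w ∈ h}) hU
    (fun w hw => by
      by_contra hn
      simp only [Set.mem_ofPred_eq, not_or] at hn
      refine hw ?_
      have hv : ∀ {y}, y ∈ X → vertexIndicator y w = 0 := fun hy => vertexIndicator_eq_zero hy hn.1
      obtain ⟨-, ⟨n1, n2, n3, n4⟩, n5, n6, n7, n8⟩ := hn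
      simp only [← T.count_eq, hv h0, hv h1, hv h2, hv h3, List.count_eq_zero_of_not_mem, n1, n2,
        n3, n4, n5, n6, n7, n8, not_false_eq_true])
    (fun w hw hw' => hX₁ w hw (hd w hw hw'))
    hX₁ hX₂ (hne (by omega)) (hne (by omega))
  have key : ∀ {p q r s : List W} {w : W}, (w ∈ p ∨ w ∈ q ∨ w ∈ r ∨ w ∈ s) →
      ∃ l, (l = p ∨ l = q ∨ l = r ∨ l = s) ∧ w ∈ l := fun {p q r s w} hw => by
    rcases hw with hw | hw | hw | hw
    exacts [⟨_, .inl rfl, hw⟩, ⟨_, .inr (.inl rfl), hw⟩, ⟨_, .inr (.inr (.inl rfl)), hw⟩,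
      ⟨_, .inr (.inr (.inr rfl)), hw⟩]
  obtain ⟨p, hp, hsp⟩ := key hs
  obtain ⟨q, hq, htq⟩ := key ht
  exact T.not_joined hN hp hq ⟨s, hsp, t, htq, r, hr⟩

end TwistedCycles

/-! ### Reduction of two longest cycles to the parallel or the twisted case -/

/-- Two cycles through `z` of length `N`, given by the lists of their vertices other than `z`,
such that `X` contains their common vertices. -/
structure CyclePair (G : SimpleGraph W) (N : ℕ) (X : Set W) (z : W) (l m : List W) : Prop where
  strand_left : Strand G z (z :: l) z
  strand_right : Strand G z (z :: m) z
  nodup_left : (z :: l).Nodup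
  nodup_right : (z :: m).Nodup
  length_left : l.length + 1 = N
  length_right : m.length + 1 = N
  base_mem : z ∈ X
  common_mem : ∀ w ∈ l, w ∈ m → w ∈ X

namespace CyclePair

variable {N : ℕ} {X : Set W} {z : W} {l m : List W}

theorem swap (h : CyclePair G N X z l m) : CyclePair G N X z m l :=
  ⟨h.strand_right, h.strand_left, h.nodup_right, h.nodup_left, h.length_right, h.length_left,
    h.base_mem, fun w h1 h2 => h.common_mem w h2 h1⟩

theorem reverse_left (h : CyclePair G N X z l m) : CyclePair G N X z l.reverse m :=
  { h with
    strand_left := h.strand_left.reverse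
    nodup_left := by simpa using h.nodup_left
    length_left := by simpa using h.length_left
    common_mem := fun w hw => h.common_mem w (by simpa using hw) }

theorem reverse_right (h : CyclePair G N X z l m) : CyclePair G N X z l m.reverse :=
  h.swap.reverse_left.swap

/-- Equality of arc lengths, required by `ParallelCycles`, is derived here from maximality. The
condition `hAB` ensures that padding by empty arcs happens at the same positions. -/
theorem false_of_parallel [DecidableEq W] (h : CyclePair G N X z l m) (hN : CircumferenceLE G N)
    (hX : ConnectedOff G X) (h4 : 4 < N) (x : Fin 4 → W) (A B : Fin 4 → List W)
    (hA : ∀ i, Strand G (x i) (A i) (x (i + 1))) (hB : ∀ i, Strand G (x i) (B i) (x (i + 1)))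
    (hl : z :: l = A 0 ++ A 1 ++ A 2 ++ A 3) (hm : z :: m = B 0 ++ B 1 ++ B 2 ++ B 3)
    (hx : ∀ i, x i ∈ X) (hAX : ∀ i, ∀ w ∈ (A i).tail, w ∉ X)
    (hBX : ∀ i, ∀ w ∈ (B i).tail, w ∉ X) (hAB : ∀ i, A i = [] ↔ B i = []) : False := by
  have hlA : ∑ i, (A i).length = N := by
    have := congrArg List.length hl
    have := h.length_left
    simp only [Fin.sum_univ_four, List.length_append, List.length_cons] at *
    omega
  have hlB : ∑ i, (B i).length = N := by
    have := congrArg List.length hm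
    have := h.length_right
    simp only [Fin.sum_univ_four, List.length_append, List.length_cons] at *
    omega
  have hcA : ∀ w, (z :: l).count w = ∑ i, (A i).count w := fun w => by
    rw [hl, Fin.sum_univ_four]; simp only [List.count_append]
  have hcB : ∀ w, (z :: m).count w = ∑ i, (B i).count w := fun w => by
    rw [hm, Fin.sum_univ_four]; simp only [List.count_append]
  have hle : ∀ i w, (B i).tail.count w ≤ (B i).count w := fun i w =>
    (List.tail_sublist _).count_le _
  -- A vertex of `X` is not inner to an arc of `B`, so only the first cycle counts it. A vertex
  -- outside `X` lies on at most one of the cycles.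
  have hU : ∀ w, ∑ i, ((A i).count w + (B i).tail.count w) ≤ 1 := fun w => by
    rw [Finset.sum_add_distrib]
    have h1 := List.nodup_iff_count_le_one.1 h.nodup_left w
    have h2 := List.nodup_iff_count_le_one.1 h.nodup_right w
    have h3 := Finset.sum_le_sum fun i (_ : i ∈ Finset.univ) => hle i w
    rw [hcA] at h1
    rw [hcB] at h2
    by_cases hw : w ∈ X
    · rw [Finset.sum_eq_zero fun i _ => List.count_eq_zero_of_not_mem fun hi => hBX i w hi hw]
      exact h1
    · by_cases hwl : w ∈ l
      · have : w ∉ z :: m := fun hwm => (List.mem_cons.1 hwm).elim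
          (fun e => hw (e ▸ h.base_mem)) fun hwm => hw (h.common_mem w hwl hwm)
        rw [← hcB w, List.count_eq_zero_of_not_mem this] at h3
        omega
      · have : w ∉ z :: l := fun hwm => (List.mem_cons.1 hwm).elim
          (fun e => hw (e ▸ h.base_mem)) hwl
        rw [← hcA w, List.count_eq_zero_of_not_mem this]
        omega
  have hhead : ∀ i w, (B i).count w ≤ (A i).count w + (B i).tail.count w := fun i w => by
    match hAi : A i, hBi : B i with
    | _, [] => simp
    | [], b :: s => simp [hAB i |>.1 hAi] at hBi
    | b :: s, b' :: s' =>
      have e1 := hA i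
      have e2 := hB i
      rw [hAi] at e1
      rw [hBi] at e2
      rw [e1.eq_cons, e2.eq_cons]
      simp only [count_cons_eq, List.tail_cons]
      omega
  have hlen : ∀ i, (B i).length ≤ (A i).length := fun i => by
    -- Replacing just the `i`-th arc of the first cycle gives a cycle again, so `B i` is no longer
    -- than `A i`. The totals agree, hence so do all the lengths.
    let C : Fin 4 → List W := fun j => if j = i then B j else A j
    have hC : ∀ j, Strand G (x j) (C j) (x (j + 1)) := fun j => by
      simp only [C]; split_ifs
      exacts [hB j, hA j]
    have := hN (x 0) _ (((hC 0).append (hC 1)).append (hC 2) |>.append (hC 3)) (by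
      refine List.nodup_iff_count_le_one.2 fun w => (le_trans ?_ (hU w))
      have : ∀ j, (C j).count w ≤ (A j).count w + (B j).tail.count w := fun j => by
        simp only [C]; split_ifs
        exacts [hhead j w, Nat.le_add_right _ _]
      have := Finset.sum_le_sum fun j (_ : j ∈ Finset.univ) => this j
      rw [Fin.sum_univ_four] at this
      simpa only [List.count_append] using this)
    have h1 : ∑ j, (C j).length ≤ ∑ j, (A j).length := by
      rw [hlA, Fin.sum_univ_four]
      simpa only [List.length_append] using this
    rw [← Finset.add_sum_erase _ _ (Finset.mem_univ i),
      ← Finset.add_sum_erase (a := i) _ (fun j => (A j).length) (Finset.mem_univ i)] at h1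
    have h2 : ∑ j ∈ Finset.univ.erase i, (C j).length =
        ∑ j ∈ Finset.univ.erase i, (A j).length :=
      Finset.sum_congr rfl fun j hj => by simp [C, (Finset.mem_erase.1 hj).1]
    have h3 : C i = B i := by simp [C]
    rw [h2, h3] at h1
    omega
  have hP : ParallelCycles G N (fun w => ∑ i, ((A i).count w + (B i).tail.count w)) x A B :=
    ⟨hA, hB, fun i => ((Finset.sum_eq_sum_iff_of_le fun i _ => hlen i).1
      (hlB.trans hlA.symm) i (Finset.mem_univ i)).symm, hlA, fun _ => rfl⟩
  refine hP.not_connectedOff hN hU hx hAX hBX ?_ hX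
  -- Without inner vertices every arc lists at most one vertex, and `N` would be at most four.
  by_contra! hne
  have : ∀ i, (A i).length ≤ 1 := fun i => by
    have := congrArg List.length (hne i)
    simp at this; omega
  have := Finset.sum_le_sum fun i (_ : i ∈ Finset.univ) => this i
  simp at this
  omega

theorem false_of_twisted [DecidableEq W] (h : CyclePair G N X z l m) (hN : CircumferenceLE G N)
    (hX : ConnectedOff G X) (h4 : 4 < N) {x₁ x₂ x₃ : W} {a a' c c' e f g k : List W}
    (hl : l = a ++ x₁ :: (e ++ x₂ :: (c ++ x₃ :: f)))
    (hm : m = a' ++ x₁ :: (g ++ x₃ :: (c' ++ x₂ :: k)))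
    (h1 : x₁ ∈ X) (h2 : x₂ ∈ X) (h3 : x₃ ∈ X)
    (hlX : ∀ w, w ∈ a ∨ w ∈ e ∨ w ∈ c ∨ w ∈ f → w ∉ X)
    (hmX : ∀ w, w ∈ a' ∨ w ∈ g ∨ w ∈ c' ∨ w ∈ k → w ∉ X) : False := by
  subst hl hm
  have sa := (List.cons_append ▸ h.strand_left :
    Strand G z ((z :: a) ++ x₁ :: (e ++ x₂ :: (c ++ x₃ :: f))) z).split
  have se := (List.cons_append ▸ sa.2 : Strand G x₁ ((x₁ :: e) ++ x₂ :: (c ++ x₃ :: f)) z).split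
  have sc := (List.cons_append ▸ se.2 : Strand G x₂ ((x₂ :: c) ++ x₃ :: f) z).split
  have sa' := (List.cons_append ▸ h.strand_right :
    Strand G z ((z :: a') ++ x₁ :: (g ++ x₃ :: (c' ++ x₂ :: k))) z).split
  have sg := (List.cons_append ▸ sa'.2 : Strand G x₁ ((x₁ :: g) ++ x₃ :: (c' ++ x₂ :: k)) z).split
  have sc' := (List.cons_append ▸ sg.2 : Strand G x₃ ((x₃ :: c') ++ x₂ :: k) z).split
  let U : W → ℕ := fun w => vertexIndicator z w + vertexIndicator x₁ w + vertexIndicator x₂ w +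
    vertexIndicator x₃ w + a.count w + a'.count w + c.count w + c'.reverse.count w + e.count w +
    f.count w + g.count w + k.count w
  have hU : ∀ w, U w ≤ 1 := fun w => by
    have c1 := List.nodup_iff_count_le_one.1 h.nodup_left w
    have c2 := List.nodup_iff_count_le_one.1 h.nodup_right w
    simp only [U, List.count_append, count_cons_eq, List.count_reverse] at c1 c2 ⊢
    by_cases hw : w ∈ X
    · have e1 := fun hh => hmX w hh hw
      have := List.count_eq_zero_of_not_mem fun hh => e1 (.inl hh)
      have := List.count_eq_zero_of_not_mem fun hh => e1 (.inr (.inl hh))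
      have := List.count_eq_zero_of_not_mem fun hh => e1 (.inr (.inr (.inl hh)))
      have := List.count_eq_zero_of_not_mem fun hh => e1 (.inr (.inr (.inr hh)))
      omega
    · have hz := vertexIndicator_eq_zero h.base_mem hw
      have e0 := h.common_mem w
      by_cases hwl : w ∈ a ++ x₁ :: (e ++ x₂ :: (c ++ x₃ :: f))
      · have := List.count_eq_zero_of_not_mem fun hh => hw (e0 hwl hh)
        simp only [List.count_append, count_cons_eq] at this
        omega
      · have := List.count_eq_zero_of_not_mem hwl
        simp only [List.count_append, count_cons_eq] at this
        omega
  have hll := h.length_left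
  have hlr := h.length_right
  have hlen : ∀ {u : W} {s : List W}, Strand G u s u → (∀ w, s.count w ≤ U w) → s.length ≤ N :=
    fun hs hc => hN _ _ hs (List.nodup_iff_count_le_one.2 fun w => (hc w).trans (hU w))
  -- Four single exchanges, `a` against `a'` and `c` against `c'` in each of the two cycles, force
  -- equal lengths within both pairs.
  have l1 := hlen (((sa'.1.append se.1).append sc.1).append sc.2) fun w => by
    simp only [U, List.count_append, count_cons_eq, List.count_reverse]; omega
  have l2 := hlen (((sa.1.append sg.1).append sc'.1).append sc'.2) fun w => by
    simp only [U, List.count_append, count_cons_eq, List.count_reverse]; omega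
  have l3 := hlen (((sa.1.append se.1).append sc'.1.reverse).append sc.2) fun w => by
    simp only [U, List.count_append, count_cons_eq, List.count_reverse]; omega
  have l4 := hlen (((sa'.1.append sg.1).append sc.1.reverse).append sc'.2) fun w => by
    simp only [U, List.count_append, count_cons_eq, List.count_reverse]; omega
  simp only [List.length_append, List.length_cons, List.length_reverse] at hll hlr l1 l2 l3 l4
  have T : TwistedCycles G N U z x₁ x₂ x₃ a a' c c'.reverse e f g k :=
    ⟨sa.1, sa'.1, sc.1, sc'.1.reverse, se.1, sc.2, sg.1, sc'.2, by omega,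
      by rw [List.length_reverse]; omega, by omega, by omega, fun _ => rfl⟩
  exact T.not_connectedOff hN hU h.base_mem h1 h2 h3 hlX (by simpa using hmX)
    (fun w hw hw' => h.common_mem w
      (by simp only [List.mem_append, List.mem_cons]; clear * - hw; tauto)
      (by simp only [List.mem_append, List.mem_cons, List.mem_reverse] at hw' ⊢
          clear * - hw'; tauto)) h4 hX

open Classical in
theorem filter_ne_twisted (h : CyclePair G N X z l m) (hN : CircumferenceLE G N)
    (hX : ConnectedOff G X) (h4 : 4 < N) {x₁ x₂ x₃ : W}
    (hl : l.filter (· ∈ X) = [x₁, x₂, x₃]) : m.filter (· ∈ X) ≠ [x₁, x₃, x₂] := by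
  intro hm
  simp only [List.filter_eq_cons_iff, List.filter_eq_nil_iff, decide_eq_true_eq] at hl hm
  obtain ⟨a, l₁, rfl, ha, h1, e, l₂, rfl, he, h2, c, f, rfl, hc, h3, hf⟩ := hl
  obtain ⟨a', l₁, rfl, ha', -, g, l₂, rfl, hg, -, c', k, rfl, hc', -, hk⟩ := hm
  refine h.false_of_twisted hN hX h4 rfl rfl h1 h2 h3 ?_ ?_
  · rintro w (hw | hw | hw | hw)
    exacts [ha w hw, he w hw, hc w hw, hf w hw]
  · rintro w (hw | hw | hw | hw)
    exacts [ha' w hw, hg w hw, hc' w hw, hk w hw]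

-- Cutting both cycles at `z` and at the listed vertices gives matching arcs. With fewer than three
-- listed vertices, empty arcs at `z` fill up to four positions.
open Classical in
theorem filter_ne_filter (h : CyclePair G N X z l m) (hN : CircumferenceLE G N)
    (hX : ConnectedOff G X) (h4 : 4 < N) (h3 : (l.filter (· ∈ X)).length ≤ 3) :
    l.filter (· ∈ X) ≠ m.filter (· ∈ X) := by
  intro hlm
  have hm := hlm.symm
  have key := @h.false_of_parallel _ _ _ _ _ _ _ _ hN hX h4
  have hz := h.base_mem
  have hl0 := h.strand_left
  have hm0 := h.strand_right
  clear hlm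
  match hl : l.filter (· ∈ X) with
  | [] =>
    rw [hl] at hm
    simp only [List.filter_eq_nil_iff, decide_eq_true_eq] at hl hm
    refine key (fun _ => z) ![z :: l, [], [], []] ![z :: m, [], [], []] (fun i => ?_) (fun i => ?_)
      (by simp) (by simp) (fun _ => hz) (fun i => ?_) (fun i => ?_) (fun i => ?_)
    · fin_cases i
      exacts [hl0, .nil _, .nil _, .nil _]
    · fin_cases i
      exacts [hm0, .nil _, .nil _, .nil _]
    · fin_cases i <;> (simp; try assumption)
    · fin_cases i <;> (simp; try assumption)
    · fin_cases i <;> simp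
  | [x₁] =>
    rw [hl] at hm
    simp only [List.filter_eq_cons_iff, List.filter_eq_nil_iff, decide_eq_true_eq] at hl hm
    obtain ⟨a, b, rfl, ha, h1, hb⟩ := hl
    obtain ⟨a', b', rfl, ha', -, hb'⟩ := hm
    have sa := (List.cons_append ▸ hl0 : Strand G z ((z :: a) ++ x₁ :: b) z).split
    have sa' := (List.cons_append ▸ hm0 : Strand G z ((z :: a') ++ x₁ :: b') z).split
    refine key ![z, x₁, z, z] ![z :: a, x₁ :: b, [], []] ![z :: a', x₁ :: b', [], []]
      (fun i => ?_) (fun i => ?_) (by simp) (by simp) (fun i => ?_) (fun i => ?_) (fun i => ?_)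
      (fun i => ?_)
    · fin_cases i
      exacts [sa.1, sa.2, .nil _, .nil _]
    · fin_cases i
      exacts [sa'.1, sa'.2, .nil _, .nil _]
    · fin_cases i <;> assumption
    · fin_cases i <;> simp <;> assumption
    · fin_cases i <;> simp <;> assumption
    · fin_cases i <;> simp
  | [x₁, x₂] =>
    rw [hl] at hm
    simp only [List.filter_eq_cons_iff, List.filter_eq_nil_iff, decide_eq_true_eq] at hl hm
    obtain ⟨a, b, rfl, ha, h1, c, d, rfl, hc, h2, hd⟩ := hl
    obtain ⟨a', b', rfl, ha', -, c', d', rfl, hc', -, hd'⟩ := hm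
    have sa := (List.cons_append ▸ hl0 : Strand G z ((z :: a) ++ x₁ :: (c ++ x₂ :: d)) z).split
    have sc := (List.cons_append ▸ sa.2 : Strand G x₁ ((x₁ :: c) ++ x₂ :: d) z).split
    have sa' := (List.cons_append ▸ hm0 : Strand G z ((z :: a') ++ x₁ :: (c' ++ x₂ :: d')) z).split
    have sc' := (List.cons_append ▸ sa'.2 : Strand G x₁ ((x₁ :: c') ++ x₂ :: d') z).split
    refine key ![z, x₁, x₂, z] ![z :: a, x₁ :: c, x₂ :: d, []] ![z :: a', x₁ :: c', x₂ :: d', []]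
      (fun i => ?_) (fun i => ?_) (by simp) (by simp) (fun i => ?_) (fun i => ?_) (fun i => ?_)
      (fun i => ?_)
    · fin_cases i
      exacts [sa.1, sc.1, sc.2, .nil _]
    · fin_cases i
      exacts [sa'.1, sc'.1, sc'.2, .nil _]
    · fin_cases i <;> assumption
    · fin_cases i <;> simp <;> assumption
    · fin_cases i <;> simp <;> assumption
    · fin_cases i <;> simp
  | [x₁, x₂, x₃] =>
    rw [hl] at hm
    simp only [List.filter_eq_cons_iff, List.filter_eq_nil_iff, decide_eq_true_eq] at hl hm
    obtain ⟨a, b, rfl, ha, h1, c, d, rfl, hc, h2, e, f, rfl, he, h3, hf⟩ := hl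
    obtain ⟨a', b', rfl, ha', -, c', d', rfl, hc', -, e', f', rfl, he', -, hf'⟩ := hm
    have sa := (List.cons_append ▸ hl0 :
      Strand G z ((z :: a) ++ x₁ :: (c ++ x₂ :: (e ++ x₃ :: f))) z).split
    have sc := (List.cons_append ▸ sa.2 :
      Strand G x₁ ((x₁ :: c) ++ x₂ :: (e ++ x₃ :: f)) z).split
    have se := (List.cons_append ▸ sc.2 : Strand G x₂ ((x₂ :: e) ++ x₃ :: f) z).split
    have sa' := (List.cons_append ▸ hm0 :
      Strand G z ((z :: a') ++ x₁ :: (c' ++ x₂ :: (e' ++ x₃ :: f'))) z).split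
    have sc' := (List.cons_append ▸ sa'.2 :
      Strand G x₁ ((x₁ :: c') ++ x₂ :: (e' ++ x₃ :: f')) z).split
    have se' := (List.cons_append ▸ sc'.2 : Strand G x₂ ((x₂ :: e') ++ x₃ :: f') z).split
    refine key ![z, x₁, x₂, x₃] ![z :: a, x₁ :: c, x₂ :: e, x₃ :: f]
      ![z :: a', x₁ :: c', x₂ :: e', x₃ :: f']
      (fun i => ?_) (fun i => ?_) (by simp) (by simp) (fun i => ?_) (fun i => ?_) (fun i => ?_)
      (fun i => ?_)
    · fin_cases i
      exacts [sa.1, sc.1, se.1, se.2]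
    · fin_cases i
      exacts [sa'.1, sc'.1, se'.1, se'.2]
    · fin_cases i <;> assumption
    · fin_cases i <;> simp <;> assumption
    · fin_cases i <;> simp <;> assumption
    · fin_cases i <;> simp
  | _ :: _ :: _ :: _ :: _ => simp [hl] at h3; omega

-- With `z` fixed, three points can be ordered in six ways on the second cycle. The given order and
-- its reverse are parallel; the other four become the twisted order after reversing one cycle, both
-- or none.
open Classical in
theorem filter_not_perm (h : CyclePair G N X z l m) (hN : CircumferenceLE G N)
    (hX : ConnectedOff G X) (h4 : 4 < N) (h3 : (l.filter (· ∈ X)).length ≤ 3) :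
    ¬ (l.filter (· ∈ X)).Perm (m.filter (· ∈ X)) := by
  intro hp
  have id1 := h.filter_ne_filter hN hX h4 h3
  have id2 := h.reverse_right.filter_ne_filter hN hX h4 h3
  have tw1 := @h.filter_ne_twisted _ _ _ _ _ _ _ hN hX h4
  have tw2 := @h.reverse_right.filter_ne_twisted _ _ _ _ _ _ _ hN hX h4
  have tw3 := @h.reverse_left.filter_ne_twisted _ _ _ _ _ _ _ hN hX h4
  have tw4 := @h.reverse_left.reverse_right.filter_ne_twisted _ _ _ _ _ _ _ hN hX h4
  rw [List.filter_reverse] at id2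
  simp only [List.filter_reverse] at tw2 tw3 tw4
  have hn : (m.filter (· ∈ X)).Nodup := (List.nodup_cons.1 h.nodup_right).2.filter _
  have hlen := hp.length_eq
  have hmem := fun x => hp.mem_iff (a := x)
  generalize m.filter (· ∈ X) = ys at *
  generalize l.filter (· ∈ X) = xs at *
  clear h hN hX h4
  match xs, ys with
  | [], [] => exact id1 rfl
  | [x₁], [y₁] => exact id1 (List.perm_singleton.1 hp.symm).symm
  | [x₁, x₂], [y₁, y₂] =>
    have a1 := (hmem y₁).2 (by simp)
    have a2 := (hmem y₂).2 (by simp)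
    simp only [List.mem_cons, List.not_mem_nil, or_false] at a1 a2
    rcases a1 with rfl | rfl <;> rcases a2 with rfl | rfl <;> simp at hn id1 id2
  | [x₁, x₂, x₃], [y₁, y₂, y₃] =>
    have a1 := (hmem y₁).2 (by simp)
    have a2 := (hmem y₂).2 (by simp)
    have a3 := (hmem y₃).2 (by simp)
    simp only [List.mem_cons, List.not_mem_nil, or_false] at a1 a2 a3
    rcases a1 with rfl | rfl | rfl <;> rcases a2 with rfl | rfl | rfl <;>
      rcases a3 with rfl | rfl | rfl <;> first
      | exact id1 rfl
      | exact id2 rfl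
      | exact tw1 rfl rfl
      | exact tw2 rfl rfl
      | exact tw3 rfl rfl
      | exact tw4 rfl rfl
      | exact absurd hn (by simp)
  | [], _ :: _ => simp at hlen
  | [_], [] => simp at hlen
  | [_], _ :: _ :: _ => simp at hlen
  | [_, _], [] => simp at hlen
  | [_, _], [_] => simp at hlen
  | [_, _], _ :: _ :: _ :: _ => simp at hlen
  | [_, _, _], [] => simp at hlen
  | [_, _, _], [_] => simp at hlen
  | [_, _, _], [_, _] => simp at hlen
  | [_, _, _], _ :: _ :: _ :: _ :: _ => simp at hlen
  | _ :: _ :: _ :: _ :: _, _ => simp at h3; omega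

end CyclePair

/-! ### From longest paths to longest cycles: the cone -/

section Cone

variable {V : Type*} {G : SimpleGraph V}

/-- The cone over `G`: a new vertex `none` is joined to all vertices of `G`. -/
def cone (G : SimpleGraph V) : SimpleGraph (Option V) where
  Adj
    | none, none => False
    | some u, some v => G.Adj u v
    | _, _ => True
  symm := ⟨fun u v => by cases u <;> cases v <;> simp [G.adj_comm]⟩
  loopless := ⟨fun u => by cases u <;> simp⟩

theorem cone_adj_some {u v : V} : (cone G).Adj (some u) (some v) ↔ G.Adj u v := Iff.rfl

theorem Walk.strand_cone {u v : V} (p : G.Walk u v) :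
    Strand (cone G) none (none :: p.support.map some) none := by
  refine .cons (v := some u) trivial ?_
  induction p with
  | nil => exact .cons (v := none) trivial (.nil _)
  | cons h p ih => exact .cons (cone_adj_some.2 h) ih

theorem Walk.exists_strand_cone {u v : V} (p : G.Walk u v) :
    ∃ l : List V, l.Sublist p.support ∧ Strand (cone G) (some u) (l.map some) (some v) := by
  induction p with
  | nil => exact ⟨[], List.nil_sublist _, .nil _⟩
  | cons h p ih =>
    obtain ⟨l, hl, hs⟩ := ih
    exact ⟨_ :: l, hl.cons_cons _, .cons (cone_adj_some.2 h) hs⟩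

theorem Strand.exists_walk {u : V} {l : List V} {w : Option V}
    (h : Strand (cone G) (some u) (some u :: l.map some) w) :
    ∃ (v : V) (p : G.Walk u v), p.support = u :: l := by
  induction l generalizing u with
  | nil => exact ⟨u, .nil, rfl⟩
  | cons a l ih =>
    cases h with
    | cons ha h =>
      obtain rfl := h.eq_cons
      obtain ⟨v, p, hp⟩ := ih h
      exact ⟨v, .cons (cone_adj_some.1 ha) p, by rw [Walk.support_cons, hp]⟩

/-- A duplicate-free strand that does not list the apex is a path of `G`. Its unlisted end `w` may
still be the apex, which is the case needed for cycles. -/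
theorem Strand.length_le_of_isLongestPath {a b : V} {P : G.Walk a b} (hP : IsLongestPath P)
    {u w : Option V} {l : List (Option V)} (h : Strand (cone G) u l w) (hn : l.Nodup)
    (hl : none ∉ l) : l.length ≤ P.length + 1 := by
  obtain ⟨m, rfl⟩ : ∃ m : List V, l = m.map some := by
    have : l ∈ Set.range (List.map (some : V → Option V)) := by
      rw [Set.range_list_map]
      intro x hx
      cases x with
      | none => exact absurd hx hl
      | some x => exact ⟨x, rfl⟩
    exact this.imp fun _ h => h.symm
  cases m with
  | nil => simp
  | cons x m =>
    obtain rfl := h.eq_cons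
    obtain ⟨v, p, hp⟩ := h.exists_walk
    have := hP.2 _ _ p (p.isPath_def.2 (hp ▸ hn.of_map some))
    have := congrArg List.length hp
    simp at this ⊢
    omega

/-- Starting a cycle at the apex and deleting the apex leaves a path of `G`, with at most `P.length
+ 1` vertices. A cycle missing the apex already contains such a path. -/
theorem IsLongestPath.circumferenceLE {a b : V} {P : G.Walk a b} (hP : IsLongestPath P) :
    CircumferenceLE (cone G) (P.length + 2) := by
  intro u l h hn
  by_cases hl : none ∈ l
  · obtain ⟨l₁, l₂, rfl⟩ := List.append_of_mem hl
    have h' := h.split.2.append h.split.1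
    rw [List.nodup_middle, List.nodup_cons] at hn
    cases h' with
    | cons _ h' =>
      have := h'.length_le_of_isLongestPath hP
        ((List.perm_append_comm.nodup_iff).1 hn.2) (by simpa [or_comm] using hn.1)
      simp at this ⊢
      omega
  · exact (h.length_le_of_isLongestPath hP hn hl).trans (Nat.le_succ _)

theorem IsLongestPath.length_eq {a b c d : V} {P : G.Walk a b} {Q : G.Walk c d}
    (hP : IsLongestPath P) (hQ : IsLongestPath Q) : P.length = Q.length :=
  le_antisymm (hQ.2 _ _ P hP.1) (hP.2 _ _ Q hQ.1)

/-- In a `k`-connected graph a vertex `u` has `k` neighbours, the second vertices of the paths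
to any other vertex. -/
theorem IsKConnected.exists_neighbors {k : ℕ} (hG : G.IsKConnected k) {u v : V} (huv : u ≠ v) :
    ∃ s : Finset V, s.card = k ∧ ∀ x ∈ s, G.Adj u x := by
  classical
  obtain ⟨S, hS, hd⟩ := hG u v huv
  refine ⟨S.image fun p : G.Path u v => (p : G.Walk u v).snd, ?_, ?_⟩
  · rw [Finset.card_image_of_injOn, hS]
    intro p hp q hq hpq
    by_contra hne
    dsimp only at hpq
    have hp0 : ¬ (p : G.Walk u v).Nil := Walk.not_nil_of_ne huv
    have hq0 : ¬ (q : G.Walk u v).Nil := Walk.not_nil_of_ne huv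
    -- Two different paths could share their second vertex only if it were `v`; but then both would
    -- be the edge `uv`.
    have key : ∀ r : G.Path u v, (r : G.Walk u v).snd = v →
        (r : G.Walk u v).support = [u, v] := by
      rintro ⟨r, hr⟩ hv
      cases r with
      | nil => exact absurd rfl huv
      | cons h r =>
        rw [Walk.snd_cons] at hv
        subst hv
        have := (Walk.cons_isPath_iff _ _).1 hr |>.1
        simp [Walk.eq_nil_iff_nil.2 (Walk.isPath_iff_nil.1 this)]
    have hpq' : (p : G.Walk u v).snd ∈ (q : G.Walk u v).support := by
      rw [hpq]; exact Walk.getVert_mem_support _ 1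
    rcases hd p hp q hq hne _ (Walk.getVert_mem_support _ 1) hpq' with h | h
    · exact (Walk.adj_snd hp0).ne h.symm
    · exact hne (Subtype.ext (Walk.ext_support ((key p h).trans (key q (hpq ▸ h)).symm)))
  · intro x hx
    obtain ⟨p, -, rfl⟩ := Finset.mem_image.1 hx
    exact Walk.adj_snd (Walk.not_nil_of_ne huv)

/-- If every one of the `k` paths met `X`, it would do so in an inner vertex, and these are distinct
for distinct paths. -/
theorem IsKConnected.exists_path_disjoint {k : ℕ} (hG : G.IsKConnected k) {X : Finset V}
    (hX : X.card < k) {u v : V} (hu : u ∉ X) (hv : v ∉ X) :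
    ∃ p : G.Path u v, ∀ x ∈ (p : G.Walk u v).support, x ∉ X := by
  by_cases huv : u = v
  · subst huv
    exact ⟨Path.nil, by simpa [Path.nil] using hu⟩
  obtain ⟨S, hS, hd⟩ := hG u v huv
  by_contra! hn
  choose f hf hfX using hn
  have := Finset.card_le_card_of_injOn (s := S) (t := X) f (fun p _ => hfX p) (by
    intro p hp q hq hpq
    by_contra hne
    rcases hd p hp q hq hne (f p) (hf p) (hpq ▸ hf q) with h | h
    · exact hu (h ▸ hfX p)
    · exact hv (h ▸ hfX p))
  omega

/-- The deleted set is `X` together with the apex, for which the condition is vacuous; what remains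
is `G` without `X`. -/
theorem IsKConnected.connectedOff_cone {k : ℕ} (hG : G.IsKConnected k) {X : Finset V}
    (hX : X.card < k) : ConnectedOff (cone G) {w | ∀ v, w = some v → v ∈ X} := by
  intro u v hu hv
  cases u with
  | none => exact absurd (fun v hv => by simp at hv) hu
  | some u =>
  cases v with
  | none => exact absurd (fun v hv => by simp at hv) hv
  | some v =>
  obtain ⟨p, hp⟩ := hG.exists_path_disjoint hX (u := u) (v := v)
    (fun h => hu fun _ e => Option.some.inj e ▸ h) (fun h => hv fun _ e => Option.some.inj e ▸ h)
  obtain ⟨l, hl, hs⟩ := (p : G.Walk u v).exists_strand_cone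
  refine ⟨_, hs, (p.2.support_nodup.sublist hl).map (Option.some_injective V), ?_⟩
  intro w hw hwX
  obtain ⟨x, hx, rfl⟩ := List.mem_map.1 hw
  exact hp x (hl.subset hx) (hwX x rfl)

/-- All neighbours of an end of a longest path lie on it, since otherwise the path could be
extended. The end and `k` neighbours make `k + 1` vertices. -/
theorem IsLongestPath.le_length [Nontrivial V] {k : ℕ} (hG : G.IsKConnected k) {a b : V}
    {P : G.Walk a b} (hP : IsLongestPath P) : k ≤ P.length := by
  classical
  obtain ⟨v, hv⟩ := exists_ne a
  obtain ⟨s, hs, hadj⟩ := hG.exists_neighbors hv.symm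
  have hsub : insert a s ⊆ P.support.toFinset := by
    intro x hx
    rw [List.mem_toFinset]
    rcases Finset.mem_insert.1 hx with rfl | hx
    · exact P.start_mem_support
    · by_contra hxP
      have := hP.2 _ _ (Walk.cons (hadj x hx).symm P) (hP.1.cons hxP)
      simp at this
  have h1 := Finset.card_le_card hsub
  rw [Finset.card_insert_of_notMem fun h => (hadj a h).ne rfl, hs] at h1
  have h2 := h1.trans P.support.toFinset_card_le
  rw [Walk.length_support] at h2
  omega

end Cone

end SimpleGraph

/-! ### Conclusion -/

theorem mainTheorem2 {V : Type*} [Finite V] [Nontrivial V] (G : SimpleGraph V)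
    (hG : G.IsKConnected 4) {a b c d : V} (P : G.Walk a b) (Q : G.Walk c d)
    (hP : SimpleGraph.IsLongestPath P) (hQ : SimpleGraph.IsLongestPath Q) :
    4 ≤ {x : V | x ∈ P.support ∧ x ∈ Q.support}.ncard := by
  classical
  by_contra! hlt
  let X : Finset V := P.support.toFinset ∩ Q.support.toFinset
  have hXmem : ∀ x, x ∈ X ↔ x ∈ P.support ∧ x ∈ Q.support := fun x => by simp [X]
  have hX : X.card < 4 := by
    rw [← Set.ncard_coe_finset, show (X : Set V) = _ from Set.ext hXmem]
    exact hlt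
  -- This makes the cycle length `P.length + 2` exceed four, so that the cycles have vertices
  -- outside the common set.
  have h4 := hP.le_length hG
  have hlen := hP.length_eq hQ
  have hconn := hG.connectedOff_cone hX
  have hY₀ : none ∈ {w : Option V | ∀ v, w = some v → v ∈ X} := fun v hv => by simp at hv
  have hY : ∀ x, some x ∈ {w : Option V | ∀ v, w = some v → v ∈ X} ↔ x ∈ X :=
    fun x => ⟨fun h => h x rfl, fun h _ e => Option.some.inj e ▸ h⟩
  generalize {w : Option V | ∀ v, w = some v → v ∈ X} = Y at hconn hY₀ hY
  have hpair : SimpleGraph.CyclePair G.cone (P.length + 2) Y none (P.support.map some)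
      (Q.support.map some) := by
    refine ⟨P.strand_cone, Q.strand_cone, ?_, ?_, by simp, by simp [hlen],
      hY₀, ?_⟩
    · simpa [List.nodup_map_iff (Option.some_injective V)] using hP.1.support_nodup
    · simpa [List.nodup_map_iff (Option.some_injective V)] using hQ.1.support_nodup
    · intro w hw hw'
      obtain ⟨x, hx, rfl⟩ := List.mem_map.1 hw
      obtain ⟨y, hy, hxy⟩ := List.mem_map.1 hw'
      exact (hY x).2 ((hXmem x).2 ⟨hx, Option.some.inj hxy ▸ hy⟩)
  have hnP := ((List.nodup_cons.1 hpair.nodup_left).2).filter fun w => decide (w ∈ Y)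
  have hnQ := ((List.nodup_cons.1 hpair.nodup_right).2).filter fun w => decide (w ∈ Y)
  -- Both paths visit exactly the vertices of `X` inside `Y`, so the two filtered lists are
  -- permutations of each other, of length at most three.
  have hmem : ∀ {u v : V} (R : G.Walk u v), (∀ x ∈ X, x ∈ R.support) → ∀ w,
      w ∈ (R.support.map some).filter (fun w => decide (w ∈ Y)) ↔ w ∈ X.image some := by
    intro u v R hR w
    simp only [List.mem_filter, List.mem_map, decide_eq_true_eq, Finset.mem_image]
    constructor
    · rintro ⟨⟨x, -, rfl⟩, hx⟩
      exact ⟨x, (hY x).1 hx, rfl⟩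
    · rintro ⟨x, hx, rfl⟩
      exact ⟨⟨x, hR x hx, rfl⟩, (hY x).2 hx⟩
  have hmP := hmem P fun x hx => ((hXmem x).1 hx).1
  have hmQ := hmem Q fun x hx => ((hXmem x).1 hx).2
  refine hpair.filter_not_perm hP.circumferenceLE hconn (by omega) ?_ ?_
  · rw [← List.toFinset_card_of_nodup hnP]
    refine le_trans (Finset.card_le_card fun w hw => (hmP w).1 (List.mem_toFinset.1 hw)) ?_
    exact Finset.card_image_le.trans (by omega)
  · exact (List.perm_ext_iff_of_nodup hnP hnQ).2 fun w => (hmP w).trans (hmQ w).symm
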